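/- Let $C$ be a commutative ring with $1$, let $A$ be an associative $C$-algebra with $1$ that is affine over $C$ (generated as a $C$-algebra by finitely many elements $a_1,\dots,a_\ell$), and let $n\ge 0$ be an integer. For $k\ge 0$ let $$\mathrm{Cap}_k(x_1,\dots,x_k;y_1,\dots,y_k)=\sum_{\pi\in S_k}\operatorname{sgn}(\pi)\,x_{\pi(1)}y_1x_{\pi(2)}y_2\cdots x_{\pi(k)}y_k$$ be the Capelli polynomial in noncommuting indeterminates (so $\mathrm{Cap}_0=1$), and let $\mathcal{CAP}_k(A)$ be the two-sided ideal of $A$ generated by all evaluations of $\mathrm{Cap}_k$ on $A$. Let $A[\xi_{n,A}]=A[\xi_{1,a},\dots,\xi_{n,a}\mid a\in A]$ be the polynomial ring over $A$ in commuting indeterminates $\xi_{i,a}$ ($1\le i\le n$, $a\in A$), which also commute with the elements of $A$. Let $I_{n,A}$ be the two-sided ideal of $A[\xi_{n,A}]$ generated by the elements $a^n+\xi_{1,a}a^{n-1}+\cdots+\xi_{n,a}$, $a\in A$, and put $\mathrm{Obst}_n(A)=A\cap I_{n,A}$, an ideal of $A$. If $A$ satisfies the identity $\mathrm{Cap}_{n+1}$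 (all evaluations of $\mathrm{Cap}_{n+1}$ on $A$ are $0$), then $$\mathrm{Obst}_n(A)\cdot(\mathcal{CAP}_n(A))^2=0 .$$ -/

import Mathlib

open scoped BigOperators

namespace BKR

noncomputable section

/-- The Capelli polynomial
`Capl_k(x_1, …, x_k; y_1, …, y_k) = ∑_{π ∈ S_k} sgn(π) x_{π(1)} y_1 ⋯ x_{π(k)} y_k`
in the free associative (unital) algebra over `C`. The indeterminates `x_i` are indexed by
`Sum.inl i`, the indeterminates `y_i` by `Sum.inr i`. -/
def capelli (C : Type*) [CommRing C] (k : ℕ) : FreeAlgebra C (Fin k ⊕ Fin k) :=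
  ∑ π : Equiv.Perm (Fin k), ((Equiv.Perm.sign π : ℤˣ) : ℤ) •
    (List.ofFn fun i : Fin k =>
      FreeAlgebra.ι C (Sum.inl (π i)) * FreeAlgebra.ι C (Sum.inr i)).prod

/-- The polynomial `f` is an identity of the `C`-algebra `A`: all its evaluations on `A` vanish. -/
def IsIdentity {C : Type*} [CommRing C] {X : Type*} (f : FreeAlgebra C X)
    (A : Type*) [Ring A] [Algebra C A] : Prop :=
  ∀ v : X → A, FreeAlgebra.lift C v f = 0

/-- The two-sided ideal `CAP_k(A)` generated by all evaluations of `Capl_k` on `A`. -/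
def capIdeal (C : Type*) [CommRing C] (k : ℕ) (A : Type*) [Ring A] [Algebra C A] :
    TwoSidedIdeal A :=
  TwoSidedIdeal.span (Set.range fun v : Fin k ⊕ Fin k → A => FreeAlgebra.lift C v (capelli C k))

/-- The polynomial ring `A[ξ_{n,A}] = A[ξ_{1,a}, …, ξ_{n,a} ∣ a ∈ A]` in central commuting
indeterminates over the (noncommutative) ring `A`: the monoid algebra over `A` of the monoid of
commutative monomials. The indeterminate `ξ_{i+1,a}` has index `(i, a)`, `i : Fin n`. -/
abbrev XiPoly (n : ℕ) (A : Type*) [Ring A] : Type _ :=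
  AddMonoidAlgebra A ((Fin n × A) →₀ ℕ)

/-- The embedding of `A` in `A[ξ_{n,A}]` as the constant polynomials. -/
def constHom (n : ℕ) (A : Type*) [Ring A] : A →+* XiPoly n A :=
  AddMonoidAlgebra.singleZeroRingHom

/-- The indeterminate `ξ_{i+1,a}`. -/
def xi {n : ℕ} {A : Type*} [Ring A] (i : Fin n) (a : A) : XiPoly n A :=
  AddMonoidAlgebra.single (Finsupp.single (i, a) 1) 1

/-- The generic integrality relation `a^n + ξ_{1,a} a^{n-1} + ⋯ + ξ_{n,a}`. -/
def integralityRelation (n : ℕ) {A : Type*} [Ring A] (a : A) : XiPoly n A :=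
  constHom n A a ^ n + ∑ i : Fin n, xi i a * constHom n A a ^ (n - (i.val + 1))

/-- The two-sided ideal `I_{n,A}` of `A[ξ_{n,A}]` generated by the generic integrality relations of
all elements of `A`. -/
def genericIdeal (n : ℕ) (A : Type*) [Ring A] : TwoSidedIdeal (XiPoly n A) :=
  TwoSidedIdeal.span (Set.range fun a : A => integralityRelation n a)

/-- The obstruction to integrality `Obst_n(A) = A ∩ I_{n,A}`, a two-sided ideal of `A`, where `A` is
identified with the constants of `A[ξ_{n,A}]`. -/
def obst (n : ℕ) (A : Type*) [Ring A] : TwoSidedIdeal A :=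
  (genericIdeal n A).comap (constHom n A)

end

end BKR

namespace BKR

open Finset

variable {A : Type*} [Ring A] {n : ℕ}

/-! The plan is to make the polynomial ring over `A` act on a module that contains every product
`cap x y * w * cap z y'`, regarded as a function of `x` and `z`, so that all integrality relations
act as zero. Then `genericIdeal` acts as zero, and an element of `obst`, which acts by left
multiplication, kills these products. The indeterminate with index `k` and element `a` acts as `(-1)
^ k` times the operator that sums over the ways of multiplying `k` entries of `z` by `a`. Vanishing
of the Capelli polynomial for `n + 1` gives Cramer-type exchange relations for `cap x y * w * ∏ z i
* y' i`. After alternation in `z` they make the function symmetric under swapping `x` and `z`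
(`altRight_swap`), so shifting `z` equals shifting `x` (`shiftLeft_altRight`). Two facts follow:
shifts commute, since one can act on `x` and the other on `z` (`shiftRight_comm`); and a
Cayley–Hamilton relation holds, because entries of `x` can be moved out to the left
(`sum_shiftLeft_eq_zero`). -/

/-! ### Exchange relations, alternation and shift operators. -/

/-- Left multiplication by `a` of the entries of `x` with index in `S`. -/
def scaleOn {ι : Type*} [DecidableEq ι] (a : A) (S : Finset ι) (x : ι → A) : ι → A :=
  fun i => if i ∈ S then a * x i else x i

/-- The functions of two families `x`, `z` which alternate in `x` and satisfy the Cramer type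
exchange relations between `x` and each entry of `z`, and between `x` and the left factor. -/
def exchangeable (n : ℕ) (A : Type*) [Ring A] :
    Submodule A ((Fin n → A) → (Fin n → A) → A) where
  carrier := {G |
    (∀ (x z : Fin n → A) (π : Equiv.Perm (Fin n)),
      G (x ∘ π) z = ((Equiv.Perm.sign π : ℤˣ) : ℤ) • G x z) ∧
    -- The free coefficient `c` makes this relation stable under scaling `z j` by `a`, which turns
    -- `c` into `a * c`. In the next relation it makes the set closed under left multiplication.
    (∀ (x z : Fin n → A) (j : Fin n) (c u : A), G x (Function.update z j (c * u)) =
      ∑ i, G (Function.update x i u) (Function.update z j (c * x i))) ∧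
    (∀ (x z : Fin n → A) (c u : A),
      u * (c * G x z) = ∑ i, x i * (c * G (Function.update x i u) z))}
  add_mem' := by
    rintro F G ⟨hF₁, hF₂, hF₃⟩ ⟨hG₁, hG₂, hG₃⟩
    refine ⟨fun x z π => ?_, fun x z j c u => ?_, fun x z c u => ?_⟩
    · simp [hF₁, hG₁]
    · simp only [Pi.add_apply, Finset.sum_add_distrib, ← hF₂, ← hG₂]
    · simp only [Pi.add_apply, mul_add, Finset.sum_add_distrib, ← hF₃, ← hG₃]
  zero_mem' := by simp
  smul_mem' := by
    rintro b G ⟨hG₁, hG₂, hG₃⟩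
    refine ⟨fun x z π => ?_, fun x z j c u => ?_, fun x z c u => ?_⟩
    · simp only [Pi.smul_apply, smul_eq_mul, hG₁, mul_smul_comm]
    · simp only [Pi.smul_apply, smul_eq_mul, hG₂ x z j c u, Finset.mul_sum]
    · simp only [Pi.smul_apply, smul_eq_mul, ← mul_assoc c b, ← hG₃]

/-- Alternation in the second family. -/
def altRight (n : ℕ) (A : Type*) [Ring A] :
    ((Fin n → A) → (Fin n → A) → A) →ₗ[A] ((Fin n → A) → (Fin n → A) → A) where
  toFun G x z := ∑ π : Equiv.Perm (Fin n), ((Equiv.Perm.sign π : ℤˣ) : ℤ) • G x (z ∘ π)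
  map_add' F G := by
    funext x z
    simp [Finset.sum_add_distrib]
  map_smul' b G := by
    funext x z
    simp only [Pi.smul_apply, smul_eq_mul, mul_smul_comm, Finset.mul_sum, RingHom.id_apply]

theorem altRight_apply (G : (Fin n → A) → (Fin n → A) → A) (x z : Fin n → A) :
    altRight n A G x z =
      ∑ π : Equiv.Perm (Fin n), ((Equiv.Perm.sign π : ℤˣ) : ℤ) • G x (z ∘ π) := rfl

/-- The sum of the evaluations with `k` entries of the second family multiplied by `a`. -/
def shiftRight (k : ℕ) (a : A) :
    ((Fin n → A) → (Fin n → A) → A) →ₗ[A] ((Fin n → A) → (Fin n → A) → A) where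
  toFun G x z := ∑ S ∈ powersetCard k univ, G x (scaleOn a S z)
  map_add' F G := by
    funext x z
    simp [Finset.sum_add_distrib]
  map_smul' b G := by
    funext x z
    simp [Finset.mul_sum]

/-- The sum of the evaluations with `k` entries of the first family multiplied by `a`. -/
def shiftLeft (k : ℕ) (a : A) (G : (Fin n → A) → (Fin n → A) → A) :
    (Fin n → A) → (Fin n → A) → A :=
  fun x z => ∑ S ∈ powersetCard k univ, G (scaleOn a S x) z

theorem shiftRight_apply (k : ℕ) (a : A) (G : (Fin n → A) → (Fin n → A) → A) (x z : Fin n → A) :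
    shiftRight k a G x z = ∑ S ∈ powersetCard k univ, G x (scaleOn a S z) := rfl

theorem shiftLeft_shiftRight (k l : ℕ) (a b : A) (G : (Fin n → A) → (Fin n → A) → A) :
    shiftLeft k a (shiftRight l b G) = shiftRight l b (shiftLeft k a G) := by
  funext x z
  simp only [shiftLeft, shiftRight_apply]
  exact Finset.sum_comm

theorem scaleOn_update_of_mem {ι : Type*} [DecidableEq ι] (a t : A) {S : Finset ι} {j : ι}
    (hj : j ∈ S) (z : ι → A) :
    scaleOn a S (Function.update z j t) = Function.update (scaleOn a S z) j (a * t) := by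
  funext i
  by_cases h : i = j
  · subst h; simp [scaleOn, hj]
  · simp [scaleOn, h]

theorem scaleOn_update_of_notMem {ι : Type*} [DecidableEq ι] (a t : A) {S : Finset ι} {j : ι}
    (hj : j ∉ S) (z : ι → A) :
    scaleOn a S (Function.update z j t) = Function.update (scaleOn a S z) j t := by
  funext i
  by_cases h : i = j
  · subst h; simp [scaleOn, hj]
  · simp [scaleOn, h]

theorem shiftRight_mem_exchangeable (k : ℕ) (a : A) {G : (Fin n → A) → (Fin n → A) → A}
    (hG : G ∈ exchangeable n A) : shiftRight k a G ∈ exchangeable n A := by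
  obtain ⟨hG₁, hG₂, hG₃⟩ := hG
  refine ⟨fun x z π => ?_, fun x z j c u => ?_, fun x z c u => ?_⟩
  · simp only [shiftRight_apply, hG₁, Finset.smul_sum]
  · simp only [shiftRight_apply]
    rw [Finset.sum_comm]
    refine Finset.sum_congr rfl fun S _ => ?_
    by_cases hj : j ∈ S
    · rw [scaleOn_update_of_mem a _ hj, ← mul_assoc, hG₂]
      simp only [scaleOn_update_of_mem a _ hj, mul_assoc]
    · rw [scaleOn_update_of_notMem a _ hj, hG₂]
      simp only [scaleOn_update_of_notMem a _ hj]
  · simp only [shiftRight_apply, Finset.mul_sum]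
    rw [Finset.sum_comm]
    exact Finset.sum_congr rfl fun S _ => hG₃ _ _ _ _

theorem scaleOn_comp {ι : Type*} [DecidableEq ι] (a : A) (S : Finset ι) (z : ι → A)
    (π : Equiv.Perm ι) :
    scaleOn a S z ∘ π = scaleOn a (S.map π.symm.toEmbedding) (z ∘ π) := by
  funext i
  simp [scaleOn]

theorem shiftRight_altRight (k : ℕ) (a : A) (G : (Fin n → A) → (Fin n → A) → A) :
    shiftRight k a (altRight n A G) = altRight n A (shiftRight k a G) := by
  funext x z
  simp only [shiftRight_apply, altRight_apply, Finset.smul_sum]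
  rw [Finset.sum_comm]
  refine Finset.sum_congr rfl fun π _ => ?_
  refine Finset.sum_equiv (Equiv.finsetCongr π.symm) (fun S => ?_) (fun S _ => ?_)
  · simp [Finset.mem_powersetCard]
  · simp [scaleOn_comp]

/-! ### Symmetry in the two families and commutation of shifts. -/

/-- If `G` satisfies the exchange relations between `x` and each entry of `z`, then alternating in
`z` amounts to exchanging all of `z` with entries of `x`. -/
theorem sum_perm_eq_sum_embedding {κ : Type*} [Fintype κ] [DecidableEq κ] (ι : Type)
    [Finite ι] : ∀ [Fintype ι] [DecidableEq ι] (G : (κ → A) → (ι → A) → A)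
    (_ : ∀ (x : κ → A) (z : ι → A) (j : ι),
      G x z = ∑ i, G (Function.update x i (z j)) (Function.update z j (x i)))
    (x : κ → A) (z : ι → A),
    ∑ π : Equiv.Perm ι, ((Equiv.Perm.sign π : ℤˣ) : ℤ) • G x (z ∘ π) =
      ∑ f : ι ↪ κ, G (Function.extend f z x) (x ∘ f) := by
  classical
  induction ι using Finite.induction_empty_option with
  | @of_equiv α β e ih =>
    intro _ _ G hG x z
    let _ : Fintype α := Fintype.ofEquiv β e.symm
    have key := ih (fun x z => G x (z ∘ e.symm)) (fun x z j => by
      rw [hG x (z ∘ e.symm) (e j)]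
      refine Finset.sum_congr rfl fun i _ => ?_
      simp [Function.update_comp_equiv]) x (z ∘ e)
    rw [← Equiv.sum_comp e.permCongr, ← Equiv.sum_comp (Equiv.embeddingCongr e (Equiv.refl κ))]
    convert key using 1
    · refine Finset.sum_congr rfl fun π _ => ?_
      rw [Equiv.Perm.sign_permCongr]
      rfl
    · refine Finset.sum_congr rfl fun f _ => ?_
      congr 1
      funext i
      by_cases h : ∃ j, f j = i
      · obtain ⟨j, rfl⟩ := h
        rw [f.injective.extend_apply]
        have : f j = (Equiv.embeddingCongr e (Equiv.refl κ) f) (e j) := by simp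
        rw [this, (Function.Embedding.injective _).extend_apply]
        rfl
      · rw [Function.extend_apply' _ _ _ h, Function.extend_apply']
        rintro ⟨j, hj⟩
        exact h ⟨e.symm j, by simpa using hj⟩
  | h_empty =>
    intro _ _ G hG x z
    have h (f : PEmpty.{1} ↪ κ) : G (Function.extend f z x) (x ∘ f) = G x z := by
      congr 1
      · funext i
        rw [Function.extend_apply']
        rintro ⟨j, _⟩
        exact j.elim
      · exact Subsingleton.elim _ _
    have h' (π : Equiv.Perm PEmpty.{1}) : z ∘ π = z := Subsingleton.elim _ _
    simp only [h, h', Fintype.sum_unique]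
    simp
  | @h_option ι _ ih =>
    intro inst₁ inst₂ G hG x z
    obtain rfl : inst₁ = instFintypeOption := Subsingleton.elim _ _
    obtain rfl : inst₂ = (fun a b => Option.instDecidableEq a b) := Subsingleton.elim _ _
    -- Permutations are split by the image of `none`; the inductive hypothesis alternates the other
    -- entries while the entry at `none` stays equal to `t`.
    have key (t : A) := ih (fun x z => G x (fun o => o.elim t z)) (fun x z j => by
      rw [hG x _ (some j)]
      refine Finset.sum_congr rfl fun i _ => ?_
      congr 1
      funext o
      cases o <;> simp [Function.update_apply])
    rw [← Equiv.sum_comp Equiv.Perm.decomposeOption.symm, Fintype.sum_prod_type,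
      Fintype.sum_option]
    have h₁ (p : Option ι) (e : Equiv.Perm ι) :
        z ∘ (Equiv.swap none p * Equiv.optionCongr e : Equiv.Perm (Option ι)) =
          fun o => o.elim (z p) ((fun i => z (Equiv.swap none p (some i))) ∘ e) := by
      funext o
      cases o <;> simp
    simp only [Equiv.Perm.decomposeOption_symm_apply, h₁, Equiv.Perm.sign_mul,
      Equiv.optionCongr_sign, Equiv.Perm.sign_swap', Units.val_mul, mul_smul, ← Finset.smul_sum, key]
    simp only [if_true, reduceCtorEq, if_false, Units.val_one, one_smul, Units.val_neg, neg_smul,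
      Finset.sum_neg_distrib]
    rw [← sub_eq_add_neg, sub_eq_iff_eq_add]
    rw [← Equiv.sum_comp (Function.Embedding.optionEmbeddingEquiv ι κ).symm,
      Fintype.sum_sigma, Finset.sum_comm, ← Finset.sum_add_distrib]
    refine Finset.sum_congr rfl fun f _ => ?_
    rw [hG _ _ none]
    -- Exchanging the entry at `none` with slot `i`: a slot outside the range of `f` extends `f` to
    -- an embedding of `Option ι`, while a slot `f p` holds `z p` and gives the term of the
    -- transposition of `none` and `p`.
    rw [← Fintype.sum_subtype_add_sum_subtype (fun i => i ∈ (Set.range f)ᶜ)]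
    congr 1
    · refine Finset.sum_congr rfl fun l _ => ?_
      have hl : ∀ i, f i ≠ l := fun i hi => l.2 ⟨i, hi⟩
      have hi (o : Option ι) : (Function.Embedding.optionEmbeddingEquiv ι κ).symm ⟨f, l⟩ o =
          o.elim (l : κ) f := by
        cases o <;> rfl
      congr 1
      · funext i
        by_cases h : i = l
        · subst h
          have h2 := hi none
          simp only [Option.elim] at h2
          rw [Function.update_self, ← h2, (Function.Embedding.injective _).extend_apply]
          rfl
        · rw [Function.update_of_ne h]
          by_cases h' : ∃ j, f j = i
          · obtain ⟨j, rfl⟩ := h'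
            have h2 := hi (some j)
            simp only [Option.elim] at h2
            rw [f.injective.extend_apply, ← h2, (Function.Embedding.injective _).extend_apply]
            rfl
          · rw [Function.extend_apply' _ _ _ h', Function.extend_apply']
            rintro ⟨_ | j, hj⟩
            · exact h ((hi none).symm.trans hj).symm
            · exact h' ⟨j, (hi (some j)).symm.trans hj⟩
      · funext o
        rcases o with _ | j
        · rw [Function.update_self, Function.comp_apply, hi none]
          simp only [Option.elim]
          rw [Function.extend_apply']
          rintro ⟨j, hj⟩
          exact hl j hj
        · simp only [Function.update_of_ne (Option.some_ne_none j), Function.comp_apply,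
            hi (some j), Option.elim]
    · symm
      refine Fintype.sum_bijective
        (fun p : ι => (⟨f p, fun h => h ⟨p, rfl⟩⟩ : {i : κ // i ∉ (Set.range f)ᶜ}))
        ⟨fun p q h => f.injective (congrArg Subtype.val h), ?_⟩ _ _ fun p => ?_
      · rintro ⟨l, hl⟩
        obtain ⟨p, rfl⟩ := not_not.1 hl
        exact ⟨p, rfl⟩
      · congr 1
        · funext i
          by_cases h' : ∃ j, f j = i
          · obtain ⟨j, rfl⟩ := h'
            rw [f.injective.extend_apply]
            by_cases hj : j = p
            · subst hj
              simp
            · rw [Function.update_of_ne (fun h => hj (f.injective h)), f.injective.extend_apply,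
                Equiv.swap_apply_of_ne_of_ne (a := none) (b := some p) (x := some j) (by simp)
                  (by simpa using hj)]
              simp
          · rw [Function.extend_apply' _ _ _ h', Function.update_of_ne, Function.extend_apply' _ _ _ h']
            rintro rfl
            exact h' ⟨p, rfl⟩
        · funext o
          rcases o with _ | j
          · simp [f.injective.extend_apply]
          · simp

/-- With equally many entries on both sides the embeddings are permutations, so the two families are
exchanged entirely; alternation in the first family supplies the signs. -/
theorem altRight_swap {G : (Fin n → A) → (Fin n → A) → A} (hG : G ∈ exchangeable n A)
    (x z : Fin n → A) : altRight n A G x z = altRight n A G z x := by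
  obtain ⟨hG₁, hG₂, -⟩ := hG
  rw [altRight_apply, sum_perm_eq_sum_embedding (Fin n) G (fun x z j => by
    simpa using hG₂ x z j 1 (z j)) x z,
    altRight_apply]
  symm
  refine Fintype.sum_bijective Equiv.toEmbedding ⟨fun π ρ h => ?_, fun f => ?_⟩ _ _ fun π => ?_
  · exact Equiv.ext fun i => DFunLike.congr_fun h i
  · exact ⟨f.equivOfFiniteSelfEmbedding, f.toEmbedding_equivOfFiniteSelfEmbedding⟩
  have h : Function.extend π.toEmbedding z x = z ∘ (π⁻¹ : Equiv.Perm (Fin n)) := by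
    funext i
    obtain ⟨j, rfl⟩ := π.surjective i
    rw [← Equiv.coe_toEmbedding, π.toEmbedding.injective.extend_apply]
    simp
  rw [h, hG₁, Equiv.Perm.sign_inv]
  rfl

theorem shiftLeft_altRight (k : ℕ) (a : A) {G : (Fin n → A) → (Fin n → A) → A}
    (hG : G ∈ exchangeable n A) :
    shiftLeft k a (altRight n A G) = shiftRight k a (altRight n A G) := by
  funext x z
  rw [shiftRight_altRight, altRight_swap (shiftRight_mem_exchangeable k a hG),
    ← shiftRight_altRight, shiftRight_apply, shiftLeft]
  exact Finset.sum_congr rfl fun S _ => altRight_swap hG _ _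

/-- One of the two shifts is transferred to the first family, where it commutes with the other for
trivial reasons, even if `a` and `b` do not commute. -/
theorem shiftRight_comm (k l : ℕ) (a b : A) {G : (Fin n → A) → (Fin n → A) → A}
    (hG : G ∈ exchangeable n A) :
    shiftRight k a (shiftRight l b (altRight n A G)) =
      shiftRight l b (shiftRight k a (altRight n A G)) := by
  rw [← shiftLeft_altRight k a hG, ← shiftLeft_shiftRight, shiftRight_altRight l b,
    shiftLeft_altRight k a (shiftRight_mem_exchangeable l b hG)]

/-! ### The Cayley–Hamilton relation for shifts. -/

theorem sum_powersetCard_succ_erase {ι M : Type*} [Fintype ι] [DecidableEq ι] [AddCommMonoid M]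
    (k : ℕ) (h : Finset ι → ι → M) :
    ∑ S ∈ powersetCard (k + 1) univ, ∑ i ∈ S, h (S.erase i) i =
      ∑ S ∈ powersetCard k univ, ∑ i ∈ Sᶜ, h S i := by
  rw [Finset.sum_sigma', Finset.sum_sigma']
  refine Finset.sum_bij' (fun p _ => ⟨p.1.erase p.2, p.2⟩) (fun p _ => ⟨insert p.2 p.1, p.2⟩)
    ?_ ?_ ?_ ?_ ?_
  · rintro ⟨S, i⟩ hp
    simp only [mem_sigma, mem_powersetCard_univ] at hp
    simp [card_erase_of_mem hp.2, hp.1]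
  · rintro ⟨S, i⟩ hp
    simp only [mem_sigma, mem_powersetCard_univ, mem_compl] at hp
    simp [card_insert_of_notMem hp.2, hp.1]
  · rintro ⟨S, i⟩ hp
    simp only [mem_sigma] at hp
    simp [insert_erase hp.2]
  · rintro ⟨S, i⟩ hp
    simp only [mem_sigma, mem_compl] at hp
    simp [erase_insert hp.2]
  · simp

theorem sum_shiftLeft_eq_zero {F : (Fin n → A) → (Fin n → A) → A}
    (hF : ∀ (x z : Fin n → A), F x z = ∑ i, x i * F (Function.update x i 1) z) (a : A)
    (x z : Fin n → A) :
    ∑ k ∈ range (n + 1), (-1 : ℤ) ^ k • (a ^ (n - k) * shiftLeft k a F x z) = 0 := by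
  -- `Q k` collects the terms whose extracted entry is unscaled. An extracted scaled entry releases
  -- a factor `a` and leaves `k - 1` scaled ones, so the `k`-th shift is `Q k + a * Q (k - 1)`. The
  -- alternating sum telescopes to `Q n`, which is zero as no unscaled index remains.
  let Q (k : ℕ) : A := ∑ S ∈ powersetCard k univ, ∑ i ∈ Sᶜ,
    x i * F (Function.update (scaleOn a S x) i 1) z
  have expand (S : Finset (Fin n)) : F (scaleOn a S x) z =
      ∑ i ∈ Sᶜ, x i * F (Function.update (scaleOn a S x) i 1) z +
      ∑ i ∈ S, a * (x i * F (Function.update (scaleOn a (S.erase i) x) i 1) z) := by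
    rw [hF, ← Finset.sum_compl_add_sum S]
    congr 1
    · refine Finset.sum_congr rfl fun i hi => ?_
      rw [mem_compl] at hi
      simp [scaleOn, hi]
    · refine Finset.sum_congr rfl fun i hi => ?_
      have : Function.update (scaleOn a S x) i 1 =
          Function.update (scaleOn a (S.erase i) x) i 1 := by
        funext j
        by_cases h : j = i
        · simp [h]
        · simp [h, scaleOn]
      rw [this]
      simp [scaleOn, hi, mul_assoc]
  have zero : shiftLeft 0 a F x z = Q 0 := by
    simp only [shiftLeft, Q, powersetCard_zero, sum_singleton]
    rw [expand]
    simp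
  have succ (k : ℕ) : shiftLeft (k + 1) a F x z = Q (k + 1) + a * Q k := by
    simp only [shiftLeft, Q, expand, Finset.sum_add_distrib, Finset.mul_sum]
    congr 1
    exact sum_powersetCard_succ_erase k fun S i =>
      a * (x i * F (Function.update (scaleOn a S x) i 1) z)
  have partial_sum (m : ℕ) (hm : m ≤ n) :
      ∑ k ∈ range (m + 1), (-1 : ℤ) ^ k • (a ^ (n - k) * shiftLeft k a F x z) =
        (-1 : ℤ) ^ m • (a ^ (n - m) * Q m) := by
    induction m with
    | zero => simp [zero]
    | succ m ih =>
      rw [Finset.sum_range_succ, ih (by omega), succ, mul_add, ← mul_assoc _ a, ← pow_succ,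
        show n - (m + 1) + 1 = n - m by omega, smul_add, pow_succ (-1 : ℤ)]
      simp
  rw [partial_sum n le_rfl]
  have : Q n = 0 := by
    refine Finset.sum_eq_zero fun S hS => ?_
    rw [mem_powersetCard_univ] at hS
    have : S = univ := by
      rw [← card_eq_iff_eq_univ, hS, Fintype.card_fin]
    simp [this]
  simp [this]

/-- The doubly alternating functions on which the polynomial ring over `A` acts. -/
def doublyAlternating (n : ℕ) (A : Type*) [Ring A] :
    Submodule A ((Fin n → A) → (Fin n → A) → A) :=
  (exchangeable n A).map (altRight n A)

theorem shiftRight_mem_doublyAlternating (k : ℕ) (a : A) (F : (Fin n → A) → (Fin n → A) → A)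
    (hF : F ∈ doublyAlternating n A) : shiftRight k a F ∈ doublyAlternating n A := by
  obtain ⟨G, hG, rfl⟩ := hF
  exact ⟨_, shiftRight_mem_exchangeable k a hG, (shiftRight_altRight k a G).symm⟩

/-- The characteristic polynomial relation for the shift operators. -/
theorem sum_shiftRight_eq_zero {F : (Fin n → A) → (Fin n → A) → A}
    (hF : F ∈ doublyAlternating n A) (a : A) :
    ∑ k ∈ range (n + 1), (-1 : ℤ) ^ k • a ^ (n - k) • shiftRight k a F = 0 := by
  obtain ⟨G, hG, rfl⟩ := hF
  funext x z
  have key := sum_shiftLeft_eq_zero (F := altRight n A G) (fun x z => by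
    have h (π : Equiv.Perm (Fin n)) := by simpa using hG.2.2 x (z ∘ π) 1 1
    simp only [altRight_apply, h, Finset.mul_sum, Finset.smul_sum, mul_smul_comm]
    exact Finset.sum_comm) a x z
  simpa [shiftLeft_altRight _ a hG] using key

/-! ### The action of the polynomial ring. -/

/-- The signed shift operator through which the indeterminates act. -/
def shiftEnd (p : Fin n × A) : AddMonoid.End (doublyAlternating n A) :=
  (-1 : ℤ) ^ (p.1.val + 1) • ((shiftRight (p.1.val + 1) p.2).restrict
    (shiftRight_mem_doublyAlternating (p.1.val + 1) p.2)).toAddMonoidHom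

theorem coe_shiftEnd (p : Fin n × A) (F : doublyAlternating n A) :
    ((shiftEnd p F : doublyAlternating n A) : (Fin n → A) → (Fin n → A) → A) =
      (-1 : ℤ) ^ (p.1.val + 1) • shiftRight (p.1.val + 1) p.2 F.1 := rfl

theorem shiftEnd_comm (p q : Fin n × A) :
    (shiftEnd p * shiftEnd q : AddMonoid.End (doublyAlternating n A)) = shiftEnd q * shiftEnd p := by
  ext1 F
  obtain ⟨F, G, hG, rfl⟩ := F
  apply Subtype.ext
  simp only [AddMonoid.End.coe_mul, Function.comp_apply, coe_shiftEnd, map_zsmul]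
  rw [shiftRight_comm _ _ _ _ hG, smul_comm]

/-- The multiplicative monoid generated by the signed shift operators. -/
abbrev shiftMonoid (n : ℕ) (A : Type*) [Ring A] :
    Submonoid (AddMonoid.End (doublyAlternating n A)) :=
  Submonoid.closure (Set.range shiftEnd)

/-- Extending the action from indeterminates to commutative monomials requires a commutative target,
which the full endomorphism ring is not. -/
instance (n : ℕ) (A : Type*) [Ring A] : CommMonoid (shiftMonoid n A) :=
  { (inferInstance : Monoid (shiftMonoid n A)) with
    mul_comm := (Submonoid.isMulCommutative_closure _ (by
      rintro _ ⟨p, rfl⟩ _ ⟨q, rfl⟩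
      exact shiftEnd_comm p q)).is_comm.comm }

/-- The action of monomials. -/
noncomputable def monomialAction (n : ℕ) (A : Type*) [Ring A] :
    Multiplicative ((Fin n × A) →₀ ℕ) →* shiftMonoid n A :=
  AddMonoidHom.toMultiplicativeLeft (Finsupp.liftAddHom fun p : Fin n × A =>
    multiplesHom (Additive (shiftMonoid n A))
      (Additive.ofMul ⟨shiftEnd p, Submonoid.subset_closure ⟨p, rfl⟩⟩))

theorem monomialAction_single (p : Fin n × A) :
    (monomialAction n A (Multiplicative.ofAdd (Finsupp.single p 1)) :
      AddMonoid.End (doublyAlternating n A)) = shiftEnd p := by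
  simp [monomialAction]

/-- The action of `A[ξ]` on the doubly alternating functions. -/
noncomputable def xiAction (n : ℕ) (A : Type*) [Ring A] :
    XiPoly n A →+* AddMonoid.End (doublyAlternating n A) :=
  AddMonoidAlgebra.liftNCRingHom (Module.toAddMonoidEnd A (doublyAlternating n A))
    ((Submonoid.subtype _).comp (monomialAction n A)) fun b m => by
      suffices h : shiftMonoid n A ≤
          Submonoid.centralizer {Module.toAddMonoidEnd A (doublyAlternating n A) b} from
        (Submonoid.mem_centralizer_iff.1 (h (monomialAction n A m).2) _ rfl)
      rw [Submonoid.closure_le]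
      rintro _ ⟨p, rfl⟩
      rw [SetLike.mem_coe, Submonoid.mem_centralizer_iff]
      rintro _ rfl
      ext1 F
      apply Subtype.ext
      have h (F : doublyAlternating n A) :
        Module.toAddMonoidEnd A (doublyAlternating n A) b F = b • F := rfl
      simp only [AddMonoid.End.coe_mul, Function.comp_apply, coe_shiftEnd, h, Submodule.coe_smul,
        map_smul]
      rw [smul_comm]

theorem xiAction_constHom (b : A) (F : doublyAlternating n A) :
    xiAction n A (constHom n A b) F = b • F := by
  have h : xiAction n A (constHom n A b) = Module.toAddMonoidEnd A (doublyAlternating n A) b *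
      (monomialAction n A 1 : AddMonoid.End (doublyAlternating n A)) :=
    AddMonoidAlgebra.liftNCRingHom_single _ _ _ _ _
  rw [h, map_one]
  rfl

theorem xiAction_xi (i : Fin n) (a : A) : xiAction n A (xi i a) = shiftEnd (i, a) := by
  have h : xiAction n A (xi i a) = Module.toAddMonoidEnd A (doublyAlternating n A) 1 *
      (monomialAction n A (Multiplicative.ofAdd (Finsupp.single (i, a) 1)) :
        AddMonoid.End (doublyAlternating n A)) :=
    AddMonoidAlgebra.liftNCRingHom_single _ _ _ _ _
  rw [h, map_one, one_mul, monomialAction_single]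

theorem xiAction_integralityRelation (a : A) : xiAction n A (integralityRelation n a) = 0 := by
  rw [integralityRelation, map_add, map_sum]
  simp only [map_mul, xiAction_xi]
  ext1 F
  apply Subtype.ext
  have key := sum_shiftRight_eq_zero F.2 a
  -- The term `k = 0` is split off to match `a ^ n`; the remaining indices become `i + 1` with `i :
  -- Fin n`.
  rw [Finset.sum_range_succ', Finset.sum_range] at key
  have h₀ : shiftRight 0 a F.1 = F.1 := by
    funext x z
    have : scaleOn a ∅ z = z := by
      funext i
      simp [scaleOn]
    simp [shiftRight_apply, this]
  rw [h₀] at key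
  rw [add_comm, ← AddMonoid.End.smul_def, add_smul, Finset.sum_smul]
  simp only [mul_smul, AddMonoid.End.smul_def, ← map_pow, xiAction_constHom]
  simp only [Submodule.coe_add, Submodule.coe_sum, coe_shiftEnd, Submodule.coe_smul, map_smul]
  simpa using key

theorem smul_eq_zero_of_mem_obst {c : A} (hc : c ∈ obst n A)
    {F : (Fin n → A) → (Fin n → A) → A} (hF : F ∈ doublyAlternating n A) : c • F = 0 := by
  have h : genericIdeal n A ≤ TwoSidedIdeal.ker (xiAction n A) := by
    rw [genericIdeal, TwoSidedIdeal.span_le]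
    rintro _ ⟨a, rfl⟩
    exact xiAction_integralityRelation a
  have h₂ := xiAction_constHom c ⟨F, hF⟩
  rw [show xiAction n A (constHom n A c) = 0 from h ((TwoSidedIdeal.mem_comap _).1 hc)] at h₂
  exact (congrArg Subtype.val h₂).symm

/-! ### Capelli polynomials and their exchange relations. -/

/-- The value of the Capelli polynomial. -/
def cap {k : ℕ} (x y : Fin k → A) : A :=
  ∑ π : Equiv.Perm (Fin k), ((Equiv.Perm.sign π : ℤˣ) : ℤ) •
    (List.ofFn fun i => x (π i) * y i).prod

theorem lift_capelli (C : Type*) [CommRing C] [Algebra C A] (k : ℕ) (v : Fin k ⊕ Fin k → A) :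
    FreeAlgebra.lift C v (capelli C k) = cap (v ∘ Sum.inl) (v ∘ Sum.inr) := by
  simp only [capelli, cap, map_sum, map_zsmul, map_list_prod, List.map_ofFn]
  congr! 5
  simp

theorem cap_comp_perm {k : ℕ} (x y : Fin k → A) (σ : Equiv.Perm (Fin k)) :
    cap (x ∘ σ) y = ((Equiv.Perm.sign σ : ℤˣ) : ℤ) • cap x y := by
  rw [cap, cap, Finset.smul_sum, ← Equiv.sum_comp (Equiv.mulLeft σ⁻¹)]
  refine Finset.sum_congr rfl fun π _ => ?_
  simp [mul_smul]

/-- Expansion of an alternating sum over `Fin (k + 1)` along the element taken by `0`. -/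
theorem sum_perm_cons {A M : Type*} [AddCommGroup M] {k : ℕ} (u : A) (x : Fin k → A)
    (Φ : A → (Fin k → A) → M) :
    ∑ π : Equiv.Perm (Fin (k + 1)), ((Equiv.Perm.sign π : ℤˣ) : ℤ) •
      Φ ((Fin.cons u x : Fin (k + 1) → A) (π 0))
        (fun i => (Fin.cons u x : Fin (k + 1) → A) (π i.succ)) =
    ∑ π : Equiv.Perm (Fin k), ((Equiv.Perm.sign π : ℤˣ) : ℤ) • Φ u (x ∘ π) -
      ∑ j, ∑ π : Equiv.Perm (Fin k), ((Equiv.Perm.sign π : ℤˣ) : ℤ) •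
        Φ (x j) (Function.update x j u ∘ π) := by
  rw [← Equiv.sum_comp Equiv.Perm.decomposeFin.symm, Fintype.sum_prod_type, Fin.sum_univ_succ,
    sub_eq_add_neg, ← Finset.sum_neg_distrib]
  congr 1
  · refine Finset.sum_congr rfl fun π _ => ?_
    simp [Equiv.Perm.decomposeFin.symm_sign, Function.comp_def]
  · refine Finset.sum_congr rfl fun j _ => ?_
    rw [← Finset.sum_neg_distrib]
    refine Finset.sum_congr rfl fun π _ => ?_
    have h (i : Fin k) : (Fin.cons u x : Fin (k + 1) → A) (Equiv.swap 0 j.succ (π i).succ) =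
        Function.update x j u (π i) := by
      by_cases hj : π i = j
      · simp [hj]
      · rw [Equiv.swap_apply_of_ne_of_ne (Fin.succ_ne_zero _) (by simpa using hj)]
        simp [hj]
    simp [Equiv.Perm.decomposeFin.symm_sign, h, Function.comp_def]

theorem cap_cons {k : ℕ} (u c : A) (x y : Fin k → A) :
    cap (Fin.cons u x : Fin (k + 1) → A) (Fin.cons c y : Fin (k + 1) → A) =
      u * (c * cap x y) - ∑ j, x j * (c * cap (Function.update x j u) y) := by
  have h := sum_perm_cons u x fun t s => t * (c * (List.ofFn fun i => s i * y i).prod)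
  simp only [cap, Finset.mul_sum, mul_smul_comm]
  refine Eq.trans ?_ h
  simp [List.ofFn_succ, mul_assoc]

/-- With last coefficient `1`, the final `x`-factor stands at the right end. Rotating the positions
brings it to the front, so the expansion along position `0` applies. -/
theorem cap_cons_snoc {k : ℕ} (u : A) (x y : Fin k → A) :
    cap (Fin.cons u x : Fin (k + 1) → A) (Fin.snoc y 1 : Fin (k + 1) → A) =
      ((Equiv.Perm.sign (finRotate (k + 1)) : ℤˣ) : ℤ) •
        (cap x y * u - ∑ j, cap (Function.update x j u) y * x j) := by
  have h := sum_perm_cons u x fun t s => (List.ofFn fun i => s i * y i).prod * t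
  simp only [cap, Finset.sum_mul, smul_mul_assoc]
  refine Eq.trans ?_ (congrArg (_ • ·) h)
  rw [← Equiv.sum_comp (Equiv.mulRight (finRotate (k + 1))), Finset.smul_sum]
  refine Finset.sum_congr rfl fun π _ => ?_
  have h (i : Fin k) : finRotate (k + 1) i.castSucc = i.succ := by
    simp
  rw [Equiv.coe_mulRight, Equiv.Perm.sign_mul, Units.val_mul, mul_comm, mul_smul]
  congr 2
  simp [-List.ofFn_succ, -finRotate_apply, List.ofFn_succ', List.concat_eq_append, h, finRotate_last]

theorem exists_prod_ofFn_update {k : ℕ} (z y : Fin k → A) (j : Fin k) :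
    ∃ p q : A, ∀ t, (List.ofFn fun i => Function.update z j t i * y i).prod = p * (t * q) := by
  induction k with
  | zero => exact j.elim0
  | succ k ih =>
    refine Fin.cases ?_ (fun j => ?_) j
    · refine ⟨1, y 0 * (List.ofFn fun i : Fin k => z i.succ * y i.succ).prod, fun t => ?_⟩
      simp [List.ofFn_succ, mul_assoc]
    · obtain ⟨p, q, h⟩ := ih (fun i => z i.succ) (fun i => y i.succ) j
      refine ⟨z 0 * y 0 * p, q, fun t => ?_⟩
      have h' (i : Fin k) : Function.update z j.succ t i.succ =
          Function.update (fun i => z i.succ) j t i := by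
        simp [Function.update_apply]
      rw [List.ofFn_succ, List.prod_cons]
      simp only [h', h]
      simp [Function.update_of_ne (Fin.succ_ne_zero j).symm, mul_assoc]

theorem cap_mul_mul (hA : ∀ x y : Fin (n + 1) → A, cap x y = 0) (x y : Fin n → A) (w u : A) :
    cap x y * w * u = ∑ i, cap (Function.update x i u) y * w * x i := by
  have key (y : Fin n → A) : cap x y * u = ∑ i, cap (Function.update x i u) y * x i := by
    have h := cap_cons_snoc u x y
    rw [hA, eq_comm] at h
    rw [← sub_eq_zero]
    rcases Int.units_eq_one_or (Equiv.Perm.sign (finRotate (n + 1))) with hs | hs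
    · rwa [hs, Units.val_one, one_smul] at h
    · rwa [hs, Units.val_neg, Units.val_one, neg_one_smul, neg_eq_zero] at h
  -- For positive `n` the factor `w` is absorbed into the last entry of `y`. For `n = 0` there is no
  -- such entry, but `key` then forces `u = 0`.
  cases n with
  | zero =>
    have := key y
    simp only [cap, Finset.univ_eq_empty, Finset.sum_empty] at this
    have hu : u = 0 := by simpa using this
    simp [hu]
  | succ m =>
    have h (x : Fin (m + 1) → A) : cap x y * w =
        cap x (Function.update y (Fin.last m) (y (Fin.last m) * w)) := by
      simp only [cap, Finset.sum_mul]
      refine Finset.sum_congr rfl fun π _ => ?_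
      simp [-List.ofFn_succ, List.ofFn_succ', List.concat_eq_append, mul_assoc]
    simp only [h, key]

theorem cap_mul_prod_mem_exchangeable (hA : ∀ x y : Fin (n + 1) → A, cap x y = 0)
    (y y' : Fin n → A) (w : A) :
    (fun x z => cap x y * w * (List.ofFn fun i => z i * y' i).prod) ∈ exchangeable n A := by
  refine ⟨fun x z π => ?_, fun x z j c u => ?_, fun x z c u => ?_⟩
  · simp only [cap_comp_perm, smul_mul_assoc]
  · obtain ⟨p, q, h⟩ := exists_prod_ofFn_update z y' j
    simp only [h]
    have := congrArg (· * q) (cap_mul_mul hA x y (w * p * c) u)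
    simpa only [Finset.sum_mul, mul_assoc] using this
  · have h := cap_cons u c x y
    rw [hA, eq_comm, sub_eq_zero] at h
    have := congrArg (· * (w * (List.ofFn fun i => z i * y' i).prod)) h
    simpa only [Finset.sum_mul, mul_assoc] using this

/-! ### Passage from Capelli values to ideals. -/

theorem cap_mul_cap_mem_doublyAlternating (hA : ∀ x y : Fin (n + 1) → A, cap x y = 0)
    (y y' : Fin n → A) (w : A) :
    (fun x z => cap x y * w * cap z y') ∈ doublyAlternating n A := by
  refine ⟨_, cap_mul_prod_mem_exchangeable hA y y' w, ?_⟩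
  funext x z
  simp only [altRight_apply, cap.eq_1 z, Finset.mul_sum, mul_smul_comm, Function.comp_apply]

theorem mul_capIdeal_mul_capIdeal (C : Type*) [CommRing C] [Algebra C A]
    (hA : ∀ x y : Fin (n + 1) → A, cap x y = 0) {c u v : A} (hc : c ∈ obst n A)
    (hu : u ∈ capIdeal C n A) (hv : v ∈ capIdeal C n A) : c * (u * v) = 0 := by
  -- Both `c` and `w` must vary in the induction on `u`: left multiples of `u` are absorbed into
  -- `c`, since `obst n A` is an ideal, and right multiples into `w`.
  have one_side : ∀ c ∈ obst n A, ∀ (w : A) (z y' : Fin n → A), c * (u * (w * cap z y')) = 0 := by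
    induction hu using TwoSidedIdeal.span_induction with
    | mem u hu =>
      obtain ⟨f, rfl⟩ := hu
      intro c hc w z y'
      have h := smul_eq_zero_of_mem_obst hc
        (cap_mul_cap_mem_doublyAlternating hA (f ∘ Sum.inr) y' w)
      simpa [lift_capelli, mul_assoc] using congrFun (congrFun h (f ∘ Sum.inl)) z
    | zero => simp
    | add u v _ _ hu hv =>
      intro c hc w z y'
      rw [add_mul, mul_add, hu c hc, hv c hc, add_zero]
    | neg u _ hu =>
      intro c hc w z y'
      rw [neg_mul, mul_neg, hu c hc, neg_zero]
    | left_absorb a u _ hu =>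
      intro c hc w z y'
      rw [mul_assoc, ← mul_assoc c]
      exact hu _ (TwoSidedIdeal.mul_mem_right _ _ _ hc) w z y'
    | right_absorb b u _ hu =>
      intro c hc w z y'
      rw [mul_assoc, ← mul_assoc b]
      exact hu c hc _ z y'
  have absorbed : ∀ w : A, c * (u * (w * v)) = 0 := by
    induction hv using TwoSidedIdeal.span_induction with
    | mem v hv =>
      obtain ⟨f, rfl⟩ := hv
      intro w
      simp only [lift_capelli]
      exact one_side c hc w _ _
    | zero => simp
    | add v v' _ _ hv hv' =>
      intro w
      rw [mul_add, mul_add, mul_add, hv, hv', add_zero]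
    | neg v _ hv =>
      intro w
      rw [mul_neg, mul_neg, mul_neg, hv, neg_zero]
    | left_absorb a v _ hv =>
      intro w
      rw [← mul_assoc w]
      exact hv _
    | right_absorb b v _ hv =>
      intro w
      rw [← mul_assoc w, ← mul_assoc u, ← mul_assoc c, hv, zero_mul]
  simpa using absorbed 1

end BKR

theorem theorem2p29 (C : Type*) [CommRing C] (A : Type*) [Ring A] [Algebra C A]
    (hA : Algebra.FiniteType C A) (n : ℕ)
    (hcap : BKR.IsIdentity (BKR.capelli C (n + 1)) A) :
    (BKR.obst n A).asIdeal * ((BKR.capIdeal C n A).asIdeal * (BKR.capIdeal C n A).asIdeal) = ⊥ := by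
  have h : ∀ x y : Fin (n + 1) → A, BKR.cap x y = 0 := fun x y => by
    simpa [BKR.lift_capelli] using hcap (Sum.elim x y)
  rw [eq_bot_iff, Submodule.mul_le]
  intro c hc s hs
  rw [Submodule.mem_bot]
  induction hs using Submodule.smul_induction_on' with
  | smul u hu v hv =>
    exact BKR.mul_capIdeal_mul_capIdeal C h (TwoSidedIdeal.mem_asIdeal.1 hc)
      (TwoSidedIdeal.mem_asIdeal.1 hu) (TwoSidedIdeal.mem_asIdeal.1 hv)
  | add s _ t _ hs ht => rw [mul_add, hs, ht, add_zero]
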